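/- Let $n\ge 1$ and $1<p<\infty$. A cube $Q\subset\mathbb{R}^n$ has sides parallel to the axes and side length $l(Q)\in(0,\infty)$; cubes are taken half-open, $Q=\prod_{i=1}^n[a_i,a_i+l(Q))$. Let $\mathbb{R}^{n+1}_+=\{(x,t):x\in\mathbb{R}^n,\ t\ge 0\}$, let $\tilde Q=\{(x,t)\in\mathbb{R}^{n+1}_+: x\in Q,\ 0\le t<l(Q)\}$, and define $$\mathcal{M}f(x,t)=\sup_{Q\ni x,\ l(Q)\ge t}\frac1{|Q|}\int_Q|f(y)|\,dy\in[0,\infty].$$ A weight is a nonnegative locally integrable function on $\mathbb{R}^n$. For a positive Borel measure $\mu$ on $\mathbb{R}^{n+1}_+$ and a weight $\sigma$ put $$[\mu,\sigma]_{S'_p}=\sup_Q\left(\frac{\int_{\tilde Q}\mathcal{M}(\sigma\chi_Q)(x,t)^p\,d\mu(x,t)}{\int_Q\sigma(x)\,dx}\right)^{1/p}\in[0,\infty],$$ where the supremum is over all cubes $Q$ and $0/0=0$, and let $\|\mathcal{M}(\sigma\,\cdot)\|_{L^p(\mathbb{R}^n,\sigma)\to L^p(\mathbb{R}^{n+1}_+,\mu)}\in[0,\infty]$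 be the infimum of the $C\in[0,\infty]$ such that $$\left(\int_{\mathbb{R}^{n+1}_+}\mathcal{M}(\sigma f)^p\,d\mu\right)^{1/p}\le C\left(\int_{\mathbb{R}^n}|f|^p\,\sigma\,dx\right)^{1/p}\quad\text{for all } f\in L^p(\mathbb{R}^n,\sigma)$$ (with $\infty\cdot 0=0$). **Theorem.** There is a constant $C\in(0,\infty)$, depending only on $n$ and $p$, such that for every positive Borel measure $\mu$ on $\mathbb{R}^{n+1}_+$ and every weight $\sigma$ on $\mathbb{R}^n$, $$[\mu,\sigma]_{S'_p}\le C\,\|\mathcal{M}(\sigma\,\cdot)\|_{L^p(\mathbb{R}^n,\sigma)\to L^p(\mathbb{R}^{n+1}_+,\mu)}\quad\text{and}\quad \|\mathcal{M}(\sigma\,\cdot)\|_{L^p(\mathbb{R}^n,\sigma)\to L^p(\mathbb{R}^{n+1}_+,\mu)}\le C\,[\mu,\sigma]_{S'_p}.$$ In particular, one side is finite if and only if the other is. -/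

import Mathlib

open MeasureTheory Set
open scoped NNReal ENNReal

noncomputable section

/-- The cube in `ℝⁿ` with sides parallel to the axes, lower corner `a` and side length `l`
(only used for `0 < l`). Cubes are half-open, so that dyadic cubes are cubes. -/
def cube {n : ℕ} (a : Fin n → ℝ) (l : ℝ) : Set (Fin n → ℝ) :=
  Set.univ.pi fun i => Set.Ico (a i) (a i + l)

/-- The set `Q̃ = {(x, t) : x ∈ Q, 0 ≤ t < l(Q)}` over the cube `Q = cube a l`. The closed upper
half-space `{(x, t) : x ∈ ℝⁿ, t ≥ 0}` is the product `(Fin n → ℝ) × ℝ≥0`. -/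
def carlesonBox {n : ℕ} (a : Fin n → ℝ) (l : ℝ) : Set ((Fin n → ℝ) × ℝ≥0) :=
  {z | z.1 ∈ cube a l ∧ (z.2 : ℝ) < l}

/-- `ℳ f (x, t)`, the supremum of the averages of `|f|` over the cubes `Q` with `x ∈ Q` and
`l(Q) ≥ t`, with values in `[0, ∞]`. -/
def carlesonMaximal {n : ℕ} (f : (Fin n → ℝ) → ℝ) (z : (Fin n → ℝ) × ℝ≥0) : ℝ≥0∞ :=
  ⨆ (a : Fin n → ℝ) (l : ℝ) (_ : 0 < l) (_ : z.1 ∈ cube a l) (_ : (z.2 : ℝ) ≤ l),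
    (∫⁻ y in cube a l, ‖f y‖ₑ) / volume (cube a l)

/-- A weight: a nonnegative locally integrable function on `ℝⁿ`. -/
structure IsWeight {n : ℕ} (σ : (Fin n → ℝ) → ℝ) : Prop where
  nonneg : ∀ᵐ x, 0 ≤ σ x
  locallyIntegrable : LocallyIntegrable σ volume

/-- The measure `σ(x) dx` on `ℝⁿ`. -/
def weightMeasure {n : ℕ} (σ : (Fin n → ℝ) → ℝ) : Measure (Fin n → ℝ) :=
  volume.withDensity fun x => ENNReal.ofReal (σ x)

/-- The testing constant `[μ, σ]_{S'_p}` in `[0, ∞]`. (For a weight `σ`, the numerator vanishes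
when `∫_Q σ = 0`, and the quotient is then `0`.) -/
def testingConstant {n : ℕ} (p : ℝ) (μ : Measure ((Fin n → ℝ) × ℝ≥0))
    (σ : (Fin n → ℝ) → ℝ) : ℝ≥0∞ :=
  ⨆ (a : Fin n → ℝ) (l : ℝ) (_ : 0 < l),
    ((∫⁻ z in carlesonBox a l, carlesonMaximal ((cube a l).indicator σ) z ^ p ∂μ) /
      ∫⁻ x in cube a l, ENNReal.ofReal (σ x)) ^ (1 / p)

/-- The operator norm of `f ↦ ℳ (σ f)` from `L^p(ℝⁿ, σ)` to `L^p(μ)`: the least `C` in `[0, ∞]`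
with `‖ℳ (σ f)‖_{L^p(μ)} ≤ C ‖f‖_{L^p(σ)}` for all `f ∈ L^p(ℝⁿ, σ)`. -/
def strongTypeNorm {n : ℕ} (p : ℝ) (μ : Measure ((Fin n → ℝ) × ℝ≥0))
    (σ : (Fin n → ℝ) → ℝ) : ℝ≥0∞ :=
  sInf {C : ℝ≥0∞ | ∀ f : (Fin n → ℝ) → ℝ, MemLp f (ENNReal.ofReal p) (weightMeasure σ) →
    (∫⁻ z, carlesonMaximal (fun x => σ x * f x) z ^ p ∂μ) ^ (1 / p) ≤
      C * eLpNorm f (ENNReal.ofReal p) (weightMeasure σ)}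

end

/-! Testing is necessary: insert `f = χ_Q`. For sufficiency, the one-third trick
(`carlesonMaximal_le_dyadic`) reduces to dyadic maximal functions of `2^n` shifted grids. In one
grid the average of `σ|f|` over `Q` is `σ(Q)/|Q|` times the `σ`-average of `|f|`. For finitely many
cubes the supremum is linearised over disjoint sets `E_Q` inside the Carleson boxes, leaving `∑ a_Q
(σ-average of |f|)^p` with `a_Q = μ(E_Q) (σ(Q)/|Q|)^p`.

On the box of `Q ⊆ R` one has `σ(Q)/|Q| ≤ ℳ(σχ_R)`. Disjointness and testing on `R` therefore give
the Carleson condition `∑_{Q ⊆ R} a_Q ≤ A σ(R)`, with `A` the `p`-th power of the testing constant.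
The embedding theorem `sum_mul_average_rpow_le`, a weak-type bound integrated over levels,
concludes. No doubling of `σ` enters, since the only tool is nestedness. -/

/-! ### Carleson embedding for nested families -/

open scoped Classical in
/-- Weak-type estimate behind the Carleson embedding theorem for a finite nested family. -/
theorem mul_sum_le_of_nested {ι X : Type*} [MeasurableSpace X] {σ : Measure X} {Q : ι → Set X}
    (hQ : ∀ i, MeasurableSet (Q i))
    (nest : ∀ i j, Q i ⊆ Q j ∨ Q j ⊆ Q i ∨ Disjoint (Q i) (Q j))
    {a : ι → ℝ≥0∞} {A c : ℝ≥0∞} {g : X → ℝ≥0∞} (F : Finset ι)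
    (carl : ∀ j ∈ F, ∑ i ∈ F with Q i ⊆ Q j, a i ≤ A * σ (Q j))
    (hc : ∀ i ∈ F, c * σ (Q i) ≤ ∫⁻ x in Q i, g x ∂σ) :
    c * ∑ i ∈ F, a i ≤ A * ∫⁻ x in ⋃ i ∈ F, Q i, g x ∂σ := by
  induction F using Finset.strongInduction with
  | H F ih =>
    rcases F.eq_empty_or_nonempty with rfl | hne
    · simp
    -- Peel off a maximal set: every other member either lies inside `Q R`, where the Carleson
    -- condition at `R` applies, or is disjoint from it.
    obtain ⟨R, hR, hmax⟩ := F.exists_maximalFor Q hne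
    set G := F.filter (fun i => ¬ Q i ⊆ Q R) with hG
    have hGF : G ⊆ F := Finset.filter_subset _ _
    have hlt : G ⊂ F := by
      refine (Finset.ssubset_iff_of_subset hGF).2 ⟨R, hR, ?_⟩
      simp [hG]
    have h1 := ih G hlt
      (fun j hj => (Finset.sum_le_sum_of_subset
        (Finset.filter_subset_filter _ hGF)).trans (carl j (hGF hj)))
      (fun i hi => hc i (hGF hi))
    have hdisj : Disjoint (⋃ i ∈ G, Q i) (Q R) := by
      simp only [Set.disjoint_iUnion_left]
      intro i hi
      have hi' := (Finset.mem_filter.1 hi)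
      rcases nest i R with h | h | h
      · exact absurd h hi'.2
      · exact absurd (hmax hi'.1 h) hi'.2
      · exact h
    have h2 : c * ∑ i ∈ F with Q i ⊆ Q R, a i ≤ A * ∫⁻ x in Q R, g x ∂σ :=
      calc c * ∑ i ∈ F with Q i ⊆ Q R, a i ≤ c * (A * σ (Q R)) := by gcongr; exact carl R hR
        _ = A * (c * σ (Q R)) := by ring
        _ ≤ _ := by gcongr; exact hc R hR
    calc c * ∑ i ∈ F, a i = c * ∑ i ∈ G, a i + c * ∑ i ∈ F with Q i ⊆ Q R, a i := by
          rw [← Finset.sum_filter_add_sum_filter_not F (fun i => Q i ⊆ Q R) a, mul_add, add_comm]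
      _ ≤ A * ∫⁻ x in ⋃ i ∈ G, Q i, g x ∂σ + A * ∫⁻ x in Q R, g x ∂σ := add_le_add h1 h2
      _ = A * ∫⁻ x in (⋃ i ∈ G, Q i) ∪ Q R, g x ∂σ := by
          rw [lintegral_union (hQ R) hdisj, mul_add]
      _ ≤ _ := by
          gcongr
          refine union_subset ?_ (subset_biUnion_of_mem (u := Q) hR)
          exact biUnion_subset_biUnion_left hGF

open scoped Classical in
/-- The weak-type estimate for averages, localized to the set where `g` is large. -/
theorem mul_sum_average_gt_le {ι X : Type*} [MeasurableSpace X] {σ : Measure X} {Q : ι → Set X}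
    (hQ : ∀ i, MeasurableSet (Q i)) (hfin : ∀ i, σ (Q i) ≠ ∞)
    (nest : ∀ i j, Q i ⊆ Q j ∨ Q j ⊆ Q i ∨ Disjoint (Q i) (Q j))
    {a : ι → ℝ≥0∞} {A c : ℝ≥0∞} {g : X → ℝ≥0∞} (hc : c ≠ ∞) (F : Finset ι)
    (carl : ∀ j ∈ F, ∑ i ∈ F with Q i ⊆ Q j, a i ≤ A * σ (Q j)) :
    c * ∑ i ∈ F with c < (∫⁻ x in Q i, g x ∂σ) / σ (Q i), a i ≤
      2 * (A * ∫⁻ x, {x | c < 2 * g x}.indicator g x ∂σ) := by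
  set G := F.filter (fun i => c < (∫⁻ x in Q i, g x ∂σ) / σ (Q i)) with hG
  have hGF : G ⊆ F := Finset.filter_subset _ _
  set g₁ := {x | c < 2 * g x}.indicator g
  -- The part of `g` below `c / 2` accounts for at most half of an average exceeding `c`; finiteness
  -- of `c * σ (Q i)` lets it be subtracted.
  have hpt : ∀ x, g x ≤ g₁ x + c / 2 := by
    intro x
    by_cases hx : c < 2 * g x
    · simp [g₁, hx]
    · simp only [g₁, indicator, mem_ofPred_eq, hx, if_false, zero_add]
      rw [ENNReal.le_div_iff_mul_le (by simp) (by simp), mul_comm]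
      exact not_lt.1 hx
  have key : c / 2 * ∑ i ∈ G, a i ≤ A * ∫⁻ x in ⋃ i ∈ G, Q i, g₁ x ∂σ := by
    refine mul_sum_le_of_nested hQ nest G
      (fun j hj => (Finset.sum_le_sum_of_subset
        (Finset.filter_subset_filter _ hGF)).trans (carl j (hGF hj))) fun i hi => ?_
    have h1 : c * σ (Q i) ≤ ∫⁻ x in Q i, g x ∂σ :=
      ENNReal.mul_le_of_le_div (Finset.mem_filter.1 hi).2.le
    have h2 : ∫⁻ x in Q i, g x ∂σ ≤ ∫⁻ x in Q i, g₁ x ∂σ + c / 2 * σ (Q i) := by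
      calc ∫⁻ x in Q i, g x ∂σ ≤ ∫⁻ x in Q i, (g₁ x + c / 2) ∂σ := lintegral_mono hpt
        _ = _ := by rw [lintegral_add_right _ measurable_const, setLIntegral_const]
    have h3 : c * σ (Q i) = c / 2 * σ (Q i) + c / 2 * σ (Q i) := by
      rw [← add_mul, ENNReal.add_halves]
    rw [h3] at h1
    refine ENNReal.le_of_add_le_add_right ?_ (h1.trans h2)
    exact ENNReal.mul_ne_top (ENNReal.div_ne_top hc (by simp)) (hfin i)
  calc c * ∑ i ∈ G, a i = 2 * (c / 2 * ∑ i ∈ G, a i) := by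
        rw [← mul_assoc, ENNReal.mul_div_cancel (by simp) (by simp)]
    _ ≤ 2 * (A * ∫⁻ x in ⋃ i ∈ G, Q i, g₁ x ∂σ) := by gcongr
    _ ≤ _ := by gcongr; exact Measure.restrict_le_self

theorem lintegral_rpow_Ioo {r : ℝ} (hr : 0 < r) (b : ℝ≥0) :
    ∫⁻ t in Ioo 0 (b : ℝ), ENNReal.ofReal (t ^ (r - 1)) =
      (b : ℝ≥0∞) ^ r / ENNReal.ofReal r := by
  have hint : IntervalIntegrable (fun t : ℝ => t ^ (r - 1)) volume 0 b :=
    intervalIntegral.intervalIntegrable_rpow' (by linarith)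
  rw [Measure.restrict_congr_set Ioo_ae_eq_Ioc, ← ofReal_integral_eq_lintegral_ofReal
    ((intervalIntegrable_iff_integrableOn_Ioc_of_le b.coe_nonneg).1 hint)
    ((ae_restrict_iff' measurableSet_Ioc).2 (.of_forall fun t ht => Real.rpow_nonneg ht.1.le _)),
    ← intervalIntegral.integral_of_le b.coe_nonneg, integral_rpow (Or.inl (by linarith))]
  simp only [sub_add_cancel, Real.zero_rpow hr.ne', sub_zero]
  rw [ENNReal.ofReal_div_of_pos hr, ← ENNReal.ofReal_rpow_of_nonneg b.coe_nonneg hr.le,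
    ENNReal.ofReal_coe_nnreal]

/-- Layer-cake formula for a power of a single number in `[0, ∞]`. -/
theorem lintegral_indicator_rpow {r : ℝ} (hr : 0 < r) (c : ℝ≥0∞) :
    ∫⁻ t in Ioi (0 : ℝ), {t : ℝ | ENNReal.ofReal t < c}.indicator
      (fun t => ENNReal.ofReal (t ^ (r - 1))) t = c ^ r / ENNReal.ofReal r := by
  have hfin : ∀ b : ℝ≥0, ∫⁻ t in Ioi (0 : ℝ), {t : ℝ | ENNReal.ofReal t < b}.indicator
      (fun t => ENNReal.ofReal (t ^ (r - 1))) t = (b : ℝ≥0∞) ^ r / ENNReal.ofReal r := by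
    intro b
    rw [← lintegral_rpow_Ioo hr b, lintegral_indicator
      (measurableSet_lt ENNReal.measurable_ofReal measurable_const), Measure.restrict_restrict
      (measurableSet_lt ENNReal.measurable_ofReal measurable_const)]
    congr 2
    ext t
    simp only [mem_inter_iff, mem_ofPred_eq, mem_Ioi, mem_Ioo]
    constructor
    · rintro ⟨h1, h2⟩
      exact ⟨h2, by rwa [← ENNReal.ofReal_coe_nnreal, ENNReal.ofReal_lt_ofReal_iff_of_nonneg h2.le]
        at h1⟩
    · rintro ⟨h1, h2⟩
      exact ⟨by rwa [← ENNReal.ofReal_coe_nnreal, ENNReal.ofReal_lt_ofReal_iff_of_nonneg h1.le], h1⟩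
  induction c with
  | coe b => exact hfin b
  | top =>
    rw [ENNReal.top_rpow_of_pos hr, ENNReal.top_div_of_ne_top ENNReal.ofReal_ne_top]
    refine ENNReal.eq_top_of_forall_nnreal_le fun d => ?_
    -- The level is chosen so that its truncated integral is exactly `d`.
    have h := hfin ((d * r.toNNReal) ^ (1 / r))
    have h2 : (((d * r.toNNReal) ^ (1 / r) : ℝ≥0) : ℝ≥0∞) ^ r / ENNReal.ofReal r = d := by
      rw [← ENNReal.coe_rpow_of_nonneg _ hr.le, ← NNReal.rpow_mul, one_div,
        inv_mul_cancel₀ hr.ne', NNReal.rpow_one, ENNReal.coe_mul]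
      exact ENNReal.mul_div_cancel_right (by simpa using hr) (by simp)
    rw [← h2, ← h]
    refine lintegral_mono fun t => ?_
    exact indicator_le_indicator_of_subset
      (fun s (hs : ENNReal.ofReal s < _) => hs.trans_le le_top) (fun _ => zero_le) t

open scoped Classical in
/-- The Carleson embedding theorem for a finite nested family. -/
theorem sum_mul_average_rpow_le {ι X : Type*} [MeasurableSpace X] {σ : Measure X} [SFinite σ]
    {Q : ι → Set X} (hQ : ∀ i, MeasurableSet (Q i)) (hfin : ∀ i, σ (Q i) ≠ ∞)
    (nest : ∀ i j, Q i ⊆ Q j ∨ Q j ⊆ Q i ∨ Disjoint (Q i) (Q j))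
    {a : ι → ℝ≥0∞} {A : ℝ≥0∞} {g : X → ℝ≥0∞} (hg : Measurable g) {p : ℝ} (hp : 1 < p)
    (F : Finset ι) (carl : ∀ j ∈ F, ∑ i ∈ F with Q i ⊆ Q j, a i ≤ A * σ (Q j)) :
    ∑ i ∈ F, a i * ((∫⁻ x in Q i, g x ∂σ) / σ (Q i)) ^ p ≤
      ENNReal.ofReal (2 ^ p * p / (p - 1)) * (A * ∫⁻ x, g x ^ p ∂σ) := by
  have hp0 : 0 < p := by linarith
  have hp1 : 0 < p - 1 := by linarith
  set e : ι → ℝ≥0∞ := fun i => (∫⁻ x in Q i, g x ∂σ) / σ (Q i)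
  have hmeas : ∀ s : ℝ, Measurable fun t : ℝ => ENNReal.ofReal (t ^ s) := fun s => by fun_prop
  have hms : ∀ c : ℝ≥0∞, MeasurableSet {t : ℝ | ENNReal.ofReal t < c} := fun c =>
    measurableSet_lt ENNReal.measurable_ofReal measurable_const
  have hset : MeasurableSet {z : ℝ × X | ENNReal.ofReal z.1 < 2 * g z.2} :=
    measurableSet_lt (by fun_prop) (by fun_prop)
  have hpos : ENNReal.ofReal p ≠ 0 := by simpa using hp0
  have hrp : ∀ i, e i ^ p = ENNReal.ofReal p * ∫⁻ t in Ioi (0 : ℝ),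
      {t : ℝ | ENNReal.ofReal t < e i}.indicator (fun t => ENNReal.ofReal (t ^ (p - 1))) t := by
    intro i
    rw [lintegral_indicator_rpow hp0, ENNReal.mul_div_cancel hpos (by simp)]
  have hsum : ∑ i ∈ F, a i * e i ^ p = ENNReal.ofReal p * ∫⁻ t in Ioi (0 : ℝ),
      ENNReal.ofReal (t ^ (p - 1)) * ∑ i ∈ F with ENNReal.ofReal t < e i, a i := by
    have : ∀ t : ℝ, ENNReal.ofReal (t ^ (p - 1)) * ∑ i ∈ F with ENNReal.ofReal t < e i, a i =
        ∑ i ∈ F, a i * {t : ℝ | ENNReal.ofReal t < e i}.indicator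
          (fun t => ENNReal.ofReal (t ^ (p - 1))) t := by
      intro t
      rw [Finset.sum_filter, Finset.mul_sum]
      refine Finset.sum_congr rfl fun i _ => ?_
      by_cases h : ENNReal.ofReal t < e i <;> simp [h, mul_comm]
    simp_rw [this]
    rw [lintegral_finsetSum _ fun i _ => ((hmeas _).indicator (hms _)).const_mul _, Finset.mul_sum]
    refine Finset.sum_congr rfl fun i _ => ?_
    rw [lintegral_const_mul _ ((hmeas _).indicator (hms _)), hrp]
    ring
  have hstep : ∀ t ∈ Ioi (0 : ℝ),
      ENNReal.ofReal (t ^ (p - 1)) * ∑ i ∈ F with ENNReal.ofReal t < e i, a i ≤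
      2 * A * ∫⁻ x, {z : ℝ × X | ENNReal.ofReal z.1 < 2 * g z.2}.indicator
        (fun z => ENNReal.ofReal (z.1 ^ (p - 1 - 1)) * g z.2) (t, x) ∂σ := by
    intro t ht
    have ht0 : (0 : ℝ) < t := ht
    have h := mul_sum_average_gt_le hQ hfin nest (g := g) (c := ENNReal.ofReal t) (by simp) F carl
    -- The weak-type bound consumes one factor `t`; the remaining `t ^ (p - 2)` is integrable at `0`
    -- because `p > 1`.
    have h1 : ENNReal.ofReal (t ^ (p - 1)) =
        ENNReal.ofReal (t ^ (p - 1 - 1)) * ENNReal.ofReal t := by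
      rw [← ENNReal.ofReal_mul (by positivity), Real.rpow_sub_one ht0.ne' (p - 1),
        div_mul_cancel₀ _ ht0.ne']
    have h2 : ∀ x, {z : ℝ × X | ENNReal.ofReal z.1 < 2 * g z.2}.indicator
        (fun z => ENNReal.ofReal (z.1 ^ (p - 1 - 1)) * g z.2) (t, x) =
        ENNReal.ofReal (t ^ (p - 1 - 1)) *
          {x | ENNReal.ofReal t < 2 * g x}.indicator g x := by
      intro x
      by_cases hx : ENNReal.ofReal t < 2 * g x <;> simp [hx]
    simp_rw [h2]
    rw [lintegral_const_mul _ (hg.indicator (measurableSet_lt measurable_const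
      (hg.const_mul 2))), h1, mul_assoc]
    refine (mul_le_mul_right h _).trans_eq ?_
    ring
  rw [hsum]
  calc _ ≤ ENNReal.ofReal p * ∫⁻ t in Ioi (0 : ℝ), 2 * A * ∫⁻ x,
          {z : ℝ × X | ENNReal.ofReal z.1 < 2 * g z.2}.indicator
          (fun z => ENNReal.ofReal (z.1 ^ (p - 1 - 1)) * g z.2) (t, x) ∂σ := by
        gcongr ENNReal.ofReal p * ?_
        exact setLIntegral_mono' measurableSet_Ioi hstep
    _ = ENNReal.ofReal p * (2 * A * ∫⁻ x, (∫⁻ t in Ioi (0 : ℝ),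
          {z : ℝ × X | ENNReal.ofReal z.1 < 2 * g z.2}.indicator
          (fun z => ENNReal.ofReal (z.1 ^ (p - 1 - 1)) * g z.2) (t, x)) ∂σ) := by
        have hm : Measurable ({z : ℝ × X | ENNReal.ofReal z.1 < 2 * g z.2}.indicator
          (fun z => ENNReal.ofReal (z.1 ^ (p - 1 - 1)) * g z.2)) := by
          refine Measurable.indicator ?_ hset
          exact ((hmeas _).comp measurable_fst).mul (hg.comp measurable_snd)
        rw [lintegral_const_mul _ hm.lintegral_prod_right',
          lintegral_lintegral_swap (f := fun t x =>
            {z : ℝ × X | ENNReal.ofReal z.1 < 2 * g z.2}.indicator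
            (fun z => ENNReal.ofReal (z.1 ^ (p - 1 - 1)) * g z.2) (t, x)) hm.aemeasurable]
    _ = ENNReal.ofReal p * (2 * A * ∫⁻ x, ENNReal.ofReal (2 ^ (p - 1) / (p - 1)) * g x ^ p ∂σ) := by
        congr 3
        funext x
        have h2 : ∀ t, {z : ℝ × X | ENNReal.ofReal z.1 < 2 * g z.2}.indicator
            (fun z => ENNReal.ofReal (z.1 ^ (p - 1 - 1)) * g z.2) (t, x) =
            {t : ℝ | ENNReal.ofReal t < 2 * g x}.indicator
              (fun t => ENNReal.ofReal (t ^ (p - 1 - 1))) t * g x := by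
          intro t
          by_cases hx : ENNReal.ofReal t < 2 * g x <;> simp [hx]
        simp_rw [h2]
        rw [lintegral_mul_const _ ((hmeas _).indicator (hms _)), lintegral_indicator_rpow hp1,
          ENNReal.mul_rpow_of_nonneg _ _ hp1.le, ENNReal.ofReal_div_of_pos hp1,
          ← ENNReal.ofReal_rpow_of_pos two_pos, ENNReal.ofReal_ofNat]
        have : g x ^ p = g x ^ (p - 1) * g x := by
          conv_rhs => rw [← ENNReal.rpow_one (g x), ← ENNReal.rpow_mul, one_mul,
            ← ENNReal.rpow_add_of_nonneg _ _ hp1.le zero_le_one, sub_add_cancel]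
        rw [this, div_eq_mul_inv, div_eq_mul_inv]
        ring
    _ = _ := by
        rw [lintegral_const_mul _ (by fun_prop)]
        have : ENNReal.ofReal (2 ^ p * p / (p - 1)) =
            ENNReal.ofReal p * (2 * ENNReal.ofReal (2 ^ (p - 1) / (p - 1))) := by
          rw [← ENNReal.ofReal_ofNat, ← ENNReal.ofReal_mul (by norm_num),
            ← ENNReal.ofReal_mul hp0.le, Real.rpow_sub_one two_ne_zero]
          congr 1
          field_simp
        rw [this]
        ring

/-! ### Linearisation and the abstract testing theorem -/

/-- The supremum of finitely many weighted indicators, written as a sum over disjoint sets. -/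
theorem exists_disjoint_sum_indicator_eq {ι Z : Type*} [MeasurableSpace Z] {B : ι → Set Z}
    (hB : ∀ i, MeasurableSet (B i)) (w : ι → ℝ≥0∞) (F : Finset ι) :
    ∃ E : ι → Set Z, (∀ i, MeasurableSet (E i)) ∧ (∀ i, E i ⊆ B i) ∧
      (F : Set ι).PairwiseDisjoint E ∧
      ∀ z, ⨆ i ∈ F, (B i).indicator (fun _ => w i) z ≤
        ∑ i ∈ F, (E i).indicator (fun _ => w i) z := by
  classical
  induction F using Finset.induction_on_max_value w with
  | empty => exact ⟨fun _ => ∅, by simp, by simp, by simp, by simp⟩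
  | insert j F hj hmax ih =>
    obtain ⟨E, hm, hsub, hdisj, hle⟩ := ih
    -- The new index `j` has the largest weight, so it keeps its whole box and the others lose their
    -- overlap with it.
    refine ⟨fun i => if i = j then B j else E i \ B j, fun i => ?_, fun i => ?_, ?_, fun z => ?_⟩
    · dsimp only
      split_ifs
      exacts [hB j, (hm i).diff (hB j)]
    · dsimp only
      split_ifs with h
      exacts [h ▸ subset_rfl, sdiff_subset.trans (hsub i)]
    · rw [Finset.coe_insert, pairwiseDisjoint_insert_of_notMem (by simpa using hj)]
      refine ⟨fun i hi k hk hik => ?_, fun i hi => ?_⟩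
      · have h1 : i ≠ j := fun h => hj (h ▸ hi)
        have h2 : k ≠ j := fun h => hj (h ▸ hk)
        simp only [Function.onFun, h1, h2, if_false]
        exact (hdisj hi hk hik).mono sdiff_subset sdiff_subset
      · have h1 : i ≠ j := fun h => hj (h ▸ hi)
        simp only [h1, if_false, if_true]
        exact disjoint_sdiff_right
    · rw [Finset.sum_insert hj]
      have hne : ∀ i ∈ F, i ≠ j := fun i hi h => hj (h ▸ hi)
      have hs : ∑ i ∈ F, (if i = j then B j else E i \ B j).indicator (fun _ => w i) z =
          ∑ i ∈ F, (E i \ B j).indicator (fun _ => w i) z :=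
        Finset.sum_congr rfl fun i hi => by rw [if_neg (hne i hi)]
      rw [hs]
      simp only [if_true]
      by_cases hz : z ∈ B j
      · refine le_trans ?_ le_self_add
        refine iSup₂_le fun i hi => ?_
        rw [indicator_of_mem hz]
        refine (indicator_le_self _ _ z).trans ?_
        rcases Finset.mem_insert.1 hi with rfl | hi
        exacts [le_rfl, hmax i hi]
      · rw [indicator_of_notMem hz, zero_add]
        have : ∑ i ∈ F, (E i \ B j).indicator (fun _ => w i) z =
            ∑ i ∈ F, (E i).indicator (fun _ => w i) z := by
          refine Finset.sum_congr rfl fun i _ => ?_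
          simp [indicator, hz]
        rw [this]
        refine le_trans (iSup₂_le fun i hi => ?_) (hle z)
        rcases Finset.mem_insert.1 hi with rfl | hi
        · rw [indicator_of_notMem hz]; exact zero_le
        · exact le_iSup₂ (f := fun i (_ : i ∈ F) => (B i).indicator (fun _ => w i) z) i hi

/-- Sawyer-type testing theorem for a countable nested family `Q` with boxes `B` above it. -/
theorem lintegral_iSup_average_rpow_le {ι X Z : Type*} [Countable ι] [MeasurableSpace X]
    [MeasurableSpace Z] {σ : Measure X} [SFinite σ] {μ : Measure Z}
    {Q : ι → Set X} (hQ : ∀ i, MeasurableSet (Q i)) (hfin : ∀ i, σ (Q i) ≠ ∞)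
    (nest : ∀ i j, Q i ⊆ Q j ∨ Q j ⊆ Q i ∨ Disjoint (Q i) (Q j))
    {B : ι → Set Z} (hB : ∀ i, MeasurableSet (B i)) (hBQ : ∀ i j, Q i ⊆ Q j → B i ⊆ B j)
    {p : ℝ} (hp : 1 < p) {s : ι → ℝ≥0∞} {M : ι → Z → ℝ≥0∞} {A : ℝ≥0∞}
    (hM : ∀ i j, Q i ⊆ Q j → ∀ z ∈ B i, s i ^ p ≤ M j z)
    (htest : ∀ j, ∫⁻ z in B j, M j z ∂μ ≤ A * σ (Q j))
    {g : X → ℝ≥0∞} (hg : Measurable g) :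
    ∫⁻ z, ⨆ i, (B i).indicator (fun _ => (s i * ((∫⁻ x in Q i, g x ∂σ) / σ (Q i))) ^ p) z ∂μ ≤
      ENNReal.ofReal (2 ^ p * p / (p - 1)) * (A * ∫⁻ x, g x ^ p ∂σ) := by
  classical
  have hp0 : 0 < p := by linarith
  set w : ι → ℝ≥0∞ := fun i => (s i * ((∫⁻ x in Q i, g x ∂σ) / σ (Q i))) ^ p
  have hmeas : ∀ i, Measurable ((B i).indicator fun _ => w i) := fun i =>
    measurable_const.indicator (hB i)
  have hmeasF : ∀ F : Finset ι, Measurable fun z => ⨆ i ∈ F, (B i).indicator (fun _ => w i) z :=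
    fun F => Measurable.biSup _ F.countable_toSet fun i _ => hmeas i
  -- Monotone convergence: a bound uniform over finite subfamilies suffices.
  rw [lintegral_congr fun z => iSup_eq_iSup_finset fun i => (B i).indicator (fun _ => w i) z,
    lintegral_iSup_directed (fun F => (hmeasF F).aemeasurable)
    (Monotone.directed_le fun F G hFG z => biSup_mono fun _ hi => Finset.mem_of_subset hFG hi)]
  refine iSup_le fun F => ?_
  obtain ⟨E, hE, hEB, hdisj, hle⟩ := exists_disjoint_sum_indicator_eq hB w F
  calc ∫⁻ z, ⨆ i ∈ F, (B i).indicator (fun _ => w i) z ∂μ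
      ≤ ∫⁻ z, ∑ i ∈ F, (E i).indicator (fun _ => w i) z ∂μ := lintegral_mono hle
    _ = ∑ i ∈ F, (μ (E i) * s i ^ p) * ((∫⁻ x in Q i, g x ∂σ) / σ (Q i)) ^ p := by
        rw [lintegral_finsetSum _ fun i _ => measurable_const.indicator (hE i)]
        refine Finset.sum_congr rfl fun i _ => ?_
        simp only [lintegral_indicator_const (hE i), w, ENNReal.mul_rpow_of_nonneg _ _ hp0.le]
        ring
    _ ≤ _ := by
        refine sum_mul_average_rpow_le hQ hfin nest hg hp F fun j _ => (htest j).trans' ?_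
        -- The Carleson condition: `M j` dominates `s i ^ p` on each `E i`, and these sets are
        -- disjoint inside `B j`.
        calc ∑ i ∈ F with Q i ⊆ Q j, μ (E i) * s i ^ p
            ≤ ∑ i ∈ F with Q i ⊆ Q j, ∫⁻ z in E i, M j z ∂μ := by
              refine Finset.sum_le_sum fun i hi => ?_
              rw [mul_comm, ← setLIntegral_const]
              exact setLIntegral_mono' (hE i) fun z hz =>
                hM i j (Finset.mem_filter.1 hi).2 z (hEB i hz)
          _ = ∫⁻ z in ⋃ i ∈ F.filter (fun i => Q i ⊆ Q j), E i, M j z ∂μ := by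
              rw [lintegral_biUnion_finset (hdisj.subset fun i hi => (Finset.mem_filter.1 hi).1)
                fun i _ => hE i]
          _ ≤ ∫⁻ z in B j, M j z ∂μ := by
              refine lintegral_mono_set (iUnion₂_subset fun i hi => ?_)
              exact (hEB i).trans (hBQ i j (Finset.mem_filter.1 hi).2)

/-! ### Shifted dyadic grids on the line -/

/-- Three times the shift of the `k`-th generation of a dyadic grid on the line. -/
def gridShift (b : Bool) (k : ℤ) : ℤ := if b then (k.negOnePow : ℤ) else 0

theorem gridShift_succ (b : Bool) (k : ℤ) : gridShift b (k + 1) = -gridShift b k := by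
  cases b <;> simp [gridShift, Int.negOnePow_succ]

/-- The index of the interval of generation `k` containing `x`. -/
noncomputable def gridIndex (b : Bool) (k : ℤ) (x : ℝ) : ℤ :=
  ⌊x / (2 : ℝ) ^ k - gridShift b k / 3⌋

/-- Alternating the sign of the shift makes it compatible with halving: `s/3` and `-2s/3` differ by
the integer `s`. Hence an interval determines its parent, which is what nests the generations. -/
theorem gridIndex_succ (b : Bool) (k : ℤ) (x : ℝ) :
    gridIndex b (k + 1) x = (gridIndex b k x + gridShift b k) / 2 := by
  have h := Int.floor_div_natCast
    (x / (2 : ℝ) ^ k - gridShift b k / 3 + (gridShift b k : ℝ)) 2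
  rw [Int.floor_add_intCast] at h
  rw [gridIndex, gridIndex, gridShift_succ, ← Nat.cast_two (R := ℤ), ← h,
    zpow_add_one₀ two_ne_zero]
  congr 1
  push_cast
  field_simp
  ring

theorem gridIndex_eq_of_le {b : Bool} {k k' : ℤ} (hk : k ≤ k') {x y : ℝ}
    (h : gridIndex b k x = gridIndex b k y) : gridIndex b k' x = gridIndex b k' y := by
  induction k', hk using Int.leInduction with
  | base => exact h
  | succ m _ ih => rw [gridIndex_succ, gridIndex_succ, ih]

/-- The one-third trick on the line. -/
theorem exists_gridIndex_eq (k : ℤ) (a l : ℝ) (hl : 3 * l ≤ 2 ^ k) :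
    ∃ b, ∀ x ∈ Ico a (a + l), gridIndex b k x = gridIndex b k a := by
  have h2 : (0 : ℝ) < 2 ^ k := by positivity
  have hx : ∀ x ∈ Ico a (a + l), a / 2 ^ k ≤ x / 2 ^ k ∧ x / 2 ^ k < a / 2 ^ k + 1 / 3 := by
    intro x hx
    refine ⟨by gcongr; exact hx.1, ?_⟩
    rw [div_lt_iff₀ h2, add_mul, div_mul_cancel₀ _ h2.ne']
    linarith [hx.2]
  have hf := Int.floor_le (a / 2 ^ k : ℝ)
  have hf' := Int.lt_floor_add_one (a / 2 ^ k : ℝ)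
  -- After rescaling the interval has length at most `1/3`. It crosses no integer if it starts at
  -- fractional part at most `2/3`; otherwise it avoids both `1/3` and `2/3` modulo `1`, the
  -- possible endpoints of the shifted grid.
  rcases le_or_gt (a / 2 ^ k - ⌊(a / 2 ^ k : ℝ)⌋ : ℝ) (2 / 3) with h | h
  · refine ⟨false, fun x hx' => ?_⟩
    simp only [gridIndex, gridShift, Bool.false_eq_true, if_false, Int.cast_zero, zero_div,
      sub_zero]
    rw [Int.floor_eq_iff]
    constructor <;> linarith [hx x hx']
  · refine ⟨true, fun x hx' => ?_⟩
    obtain ⟨h3, h4⟩ := hx x hx'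
    simp only [gridIndex, gridShift, if_true]
    rcases Int.even_or_odd k with hk | hk
    · rw [Int.negOnePow_even _ hk]
      push_cast
      trans ⌊(a / 2 ^ k : ℝ)⌋
      · rw [Int.floor_eq_iff]; constructor <;> linarith
      · symm; rw [Int.floor_eq_iff]; constructor <;> linarith
    · rw [Int.negOnePow_odd _ hk]
      push_cast
      trans ⌊(a / 2 ^ k : ℝ)⌋ + 1
      · rw [Int.floor_eq_iff]; push_cast; constructor <;> linarith
      · symm; rw [Int.floor_eq_iff]; push_cast; constructor <;> linarith

/-! ### Cubes, dyadic grids and the one-third trick in `ℝⁿ` -/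

section Cubes

variable {n : ℕ}

theorem measurableSet_cube (a : Fin n → ℝ) (l : ℝ) : MeasurableSet (cube a l) :=
  MeasurableSet.univ_pi fun _ => measurableSet_Ico

theorem volume_cube (a : Fin n → ℝ) (l : ℝ) : volume (cube a l) = ENNReal.ofReal l ^ n := by
  have : cube a l = Set.univ.pi fun i => Ico (a i) ((fun i => a i + l) i) := rfl
  rw [this, Real.volume_pi_Ico]
  simp

theorem measurableSet_carlesonBox (a : Fin n → ℝ) (l : ℝ) : MeasurableSet (carlesonBox a l) :=
  (measurableSet_cube a l).prod (measurableSet_lt measurable_coe_nnreal_real measurable_const)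

/-- The lower corner of a dyadic cube of generation `k` in the grid with shift type `α`. -/
noncomputable def dyadicCorner (α : Fin n → Bool) (k : ℤ) (m : Fin n → ℤ) : Fin n → ℝ :=
  fun i => 2 ^ k * (m i + gridShift (α i) k / 3)

/-- The dyadic cubes of the grid with shift type `α`, indexed by generation and position. -/
def dyadicCube (α : Fin n → Bool) (q : ℤ × (Fin n → ℤ)) : Set (Fin n → ℝ) :=
  cube (dyadicCorner α q.1 q.2) (2 ^ q.1)

theorem mem_dyadicCube {α : Fin n → Bool} {q : ℤ × (Fin n → ℤ)} {x : Fin n → ℝ} :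
    x ∈ dyadicCube α q ↔ ∀ i, gridIndex (α i) q.1 (x i) = q.2 i := by
  have h2 : (0 : ℝ) < 2 ^ q.1 := by positivity
  simp only [dyadicCube, cube, Set.mem_univ_pi, mem_Ico, dyadicCorner, gridIndex, Int.floor_eq_iff]
  refine forall_congr' fun i => and_congr ?_ ?_
  · rw [le_sub_iff_add_le, le_div_iff₀ h2, mul_comm]
  · rw [sub_lt_iff_lt_add, div_lt_iff₀ h2]
    ring_nf

theorem dyadicCube_subset_of_le {α : Fin n → Bool} {q r : ℤ × (Fin n → ℤ)} (h : q.1 ≤ r.1)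
    (hd : ¬ Disjoint (dyadicCube α q) (dyadicCube α r)) : dyadicCube α q ⊆ dyadicCube α r := by
  obtain ⟨y, hy, hy'⟩ := Set.not_disjoint_iff.1 hd
  rw [mem_dyadicCube] at hy hy'
  intro x hx
  rw [mem_dyadicCube] at hx ⊢
  intro i
  rw [← hy' i]
  exact gridIndex_eq_of_le h ((hx i).trans (hy i).symm)

theorem dyadicCube_nested (α : Fin n → Bool) (q r : ℤ × (Fin n → ℤ)) :
    dyadicCube α q ⊆ dyadicCube α r ∨ dyadicCube α r ⊆ dyadicCube α q ∨
      Disjoint (dyadicCube α q) (dyadicCube α r) := by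
  by_cases hd : Disjoint (dyadicCube α q) (dyadicCube α r)
  · exact Or.inr (Or.inr hd)
  rcases le_total q.1 r.1 with h | h
  · exact Or.inl (dyadicCube_subset_of_le h hd)
  · exact Or.inr (Or.inl (dyadicCube_subset_of_le h fun h' => hd h'.symm))

/-- Volumes are compared. In dimension `0` all cubes coincide and the side length cannot be
recovered. -/
theorem le_of_cube_subset (hn : 1 ≤ n) {a b : Fin n → ℝ} {l m : ℝ} (hm : 0 ≤ m)
    (h : cube a l ⊆ cube b m) : l ≤ m := by
  have h1 := measure_mono (μ := volume) h
  rw [volume_cube, volume_cube] at h1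
  have h2 := (ENNReal.pow_le_pow_left_iff (by omega)).1 h1
  exact (ENNReal.ofReal_le_ofReal_iff hm).1 h2

theorem carlesonBox_subset (hn : 1 ≤ n) {a b : Fin n → ℝ} {l m : ℝ} (hm : 0 ≤ m)
    (h : cube a l ⊆ cube b m) : carlesonBox a l ⊆ carlesonBox b m :=
  fun _ hz => ⟨h hz.1, hz.2.trans_le (le_of_cube_subset hn hm h)⟩

/-- The Carleson box over a dyadic cube. -/
def dyadicBox (α : Fin n → Bool) (q : ℤ × (Fin n → ℤ)) : Set ((Fin n → ℝ) × ℝ≥0) :=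
  carlesonBox (dyadicCorner α q.1 q.2) (2 ^ q.1)

/-- The one-third trick: `carlesonMaximal` is dominated by finitely many dyadic maximal
functions. -/
theorem carlesonMaximal_le_dyadic (f : (Fin n → ℝ) → ℝ) (z : (Fin n → ℝ) × ℝ≥0) :
    carlesonMaximal f z ≤ 6 ^ n * ⨆ (α : Fin n → Bool) (q : ℤ × (Fin n → ℤ)),
      (dyadicBox α q).indicator
        (fun _ => (∫⁻ y in dyadicCube α q, ‖f y‖ₑ) / volume (dyadicCube α q)) z := by
  refine iSup_le fun a => iSup_le fun l => iSup_le fun hl => iSup_le fun hz => iSup_le fun ht => ?_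
  -- Then `3l < 2 ^ (k + 1) ≤ 6l`: the lower bound allows the one-third trick in each coordinate,
  -- the upper one gives the factor `6 ^ n`.
  obtain ⟨k, hk1, hk2⟩ := exists_mem_Ico_zpow (x := 3 * l) (y := (2 : ℝ)) (by positivity)
    one_lt_two
  rw [zpow_add_one₀ two_ne_zero] at hk2
  have h3 : 3 * l ≤ (2 : ℝ) ^ (k + 1) := by rw [zpow_add_one₀ two_ne_zero]; exact hk2.le
  choose α hα using fun i => exists_gridIndex_eq (k + 1) (a i) l h3
  set q : ℤ × (Fin n → ℤ) := (k + 1, fun i => gridIndex (α i) (k + 1) (a i))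
  have hsub : cube a l ⊆ dyadicCube α q := fun x hx =>
    mem_dyadicCube.2 fun i => hα i (x i) (hx i trivial)
  have hzB : z ∈ dyadicBox α q := ⟨hsub hz, by
    show (z.2 : ℝ) < 2 ^ (k + 1)
    linarith⟩
  have hvol : volume (dyadicCube α q) ≤ 6 ^ n * volume (cube a l) := by
    rw [dyadicCube, volume_cube, volume_cube, ← mul_pow]
    gcongr
    rw [← ENNReal.ofReal_ofNat, ← ENNReal.ofReal_mul (by norm_num)]
    apply ENNReal.ofReal_le_ofReal
    show (2 : ℝ) ^ (k + 1) ≤ 6 * l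
    rw [zpow_add_one₀ two_ne_zero]
    linarith
  calc (∫⁻ y in cube a l, ‖f y‖ₑ) / volume (cube a l)
      ≤ (∫⁻ y in dyadicCube α q, ‖f y‖ₑ) / (volume (dyadicCube α q) / 6 ^ n) := by
        gcongr
        rw [mul_comm] at hvol
        exact ENNReal.div_le_of_le_mul hvol
    _ = 6 ^ n * ((∫⁻ y in dyadicCube α q, ‖f y‖ₑ) / volume (dyadicCube α q)) := by
        rw [div_eq_mul_inv, ENNReal.inv_div (by simp) (by simp), div_eq_mul_inv, div_eq_mul_inv]
        ring
    _ ≤ _ := by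
        gcongr
        refine le_iSup₂_of_le α q ?_
        rw [indicator_of_mem hzB]

theorem le_carlesonMaximal {f : (Fin n → ℝ) → ℝ} {z : (Fin n → ℝ) × ℝ≥0} {a : Fin n → ℝ} {l : ℝ}
    (hl : 0 < l) (hz : z ∈ carlesonBox a l) :
    (∫⁻ y in cube a l, ‖f y‖ₑ) / volume (cube a l) ≤ carlesonMaximal f z :=
  le_iSup_of_le a <| le_iSup_of_le l <| le_iSup_of_le hl <| le_iSup_of_le hz.1 <|
    le_iSup_of_le hz.2.le le_rfl

theorem weightMeasure_cube (σ : (Fin n → ℝ) → ℝ) (a : Fin n → ℝ) (l : ℝ) :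
    weightMeasure σ (cube a l) = ∫⁻ x in cube a l, ENNReal.ofReal (σ x) :=
  withDensity_apply _ (measurableSet_cube a l)

/-! ### The two inequalities for a weight -/

namespace IsWeight

variable {σ : (Fin n → ℝ) → ℝ}

theorem aemeasurable (hσ : IsWeight σ) : AEMeasurable σ :=
  hσ.locallyIntegrable.aestronglyMeasurable.aemeasurable

theorem ae_enorm_eq (hσ : IsWeight σ) : ∀ᵐ x, ‖σ x‖ₑ = ENNReal.ofReal (σ x) := by
  filter_upwards [hσ.nonneg] with x hx
  exact Real.enorm_of_nonneg hx

theorem weightMeasure_cube_ne_top (hσ : IsWeight σ) (a : Fin n → ℝ) (l : ℝ) :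
    weightMeasure σ (cube a l) ≠ ∞ := by
  have hK : IsCompact (Icc a fun i => a i + l) := isCompact_Icc
  have hsub : cube a l ⊆ Icc a fun i => a i + l := fun x hx =>
    ⟨fun i => (hx i trivial).1, fun i => (hx i trivial).2.le⟩
  have h := (hσ.locallyIntegrable.integrableOn_isCompact hK).mono_set hsub
  rw [weightMeasure_cube]
  exact ((lintegral_mono fun x => Real.ofReal_le_enorm (σ x)).trans_lt h.2).ne

/-- Here `f` may be non-measurable on `{σ = 0}`, where the factor `σ` annihilates it. -/
theorem setLIntegral_enorm_mul (hσ : IsWeight σ) {f : (Fin n → ℝ) → ℝ}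
    (hf : AEMeasurable f (weightMeasure σ)) {s : Set (Fin n → ℝ)} (hs : MeasurableSet s) :
    ∫⁻ x in s, ‖σ x * f x‖ₑ = ∫⁻ x in s, ‖f x‖ₑ ∂weightMeasure σ := by
  have hf' : AEMeasurable (fun x => ‖f x‖ₑ)
      ((volume.restrict s).withDensity fun x => ENNReal.ofReal (σ x)) := by
    rw [← restrict_withDensity hs]
    exact hf.enorm.restrict
  rw [weightMeasure, restrict_withDensity hs, lintegral_withDensity_eq_lintegral_mul₀'
    hσ.aemeasurable.ennreal_ofReal.restrict hf']
  refine lintegral_congr_ae (ae_restrict_of_ae ?_)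
  filter_upwards [hσ.ae_enorm_eq] with x hx
  rw [enorm_mul, hx, Pi.mul_apply]

/-- The testing inequality over one cube. -/
theorem lintegral_carlesonBox_le (hσ : IsWeight σ) {p : ℝ} (hp : 1 < p)
    (μ : Measure ((Fin n → ℝ) × ℝ≥0)) (a : Fin n → ℝ) {l : ℝ} (hl : 0 < l) :
    ∫⁻ z in carlesonBox a l, carlesonMaximal ((cube a l).indicator σ) z ^ p ∂μ ≤
      testingConstant p μ σ ^ p * weightMeasure σ (cube a l) := by
  have hp0 : 0 < p := by linarith
  -- With the convention `0/0 = 0` the quotient gives no information when `σ(Q) = 0`; the numerator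
  -- must be shown to vanish.
  by_cases h0 : weightMeasure σ (cube a l) = 0
  · have hz : ∀ z, carlesonMaximal ((cube a l).indicator σ) z = 0 := by
      have h1 : ∀ᵐ x, ‖(cube a l).indicator σ x‖ₑ = 0 := by
        rw [weightMeasure_cube, lintegral_eq_zero_iff' hσ.aemeasurable.ennreal_ofReal.restrict,
          Filter.EventuallyEq, ae_restrict_iff' (measurableSet_cube a l)] at h0
        filter_upwards [h0, hσ.ae_enorm_eq] with x hx hx'
        by_cases h : x ∈ cube a l
        · rw [indicator_of_mem h, hx', hx h, Pi.zero_apply]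
        · rw [indicator_of_notMem h, enorm_zero]
      intro z
      simp only [carlesonMaximal, ENNReal.iSup_eq_zero]
      intro b m _ _ _
      rw [lintegral_congr_ae (ae_restrict_of_ae h1), lintegral_zero, ENNReal.zero_div]
    simp [hz, hp0]
  · have h := le_iSup_of_le a (le_iSup₂_of_le l hl le_rfl) |>.trans_eq
      (rfl : _ = testingConstant p μ σ)
    rw [one_div, ENNReal.rpow_inv_le_iff hp0, ← weightMeasure_cube,
      ENNReal.div_le_iff h0 (hσ.weightMeasure_cube_ne_top a l)] at h
    exact h

theorem testingConstant_le (hσ : IsWeight σ) {p : ℝ} (hp : 1 < p)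
    (μ : Measure ((Fin n → ℝ) × ℝ≥0)) : testingConstant p μ σ ≤ strongTypeNorm p μ σ := by
  have hp0 : 0 < p := by linarith
  refine le_sInf fun C hC => iSup_le fun a => iSup₂_le fun l hl => ?_
  have hm := measurableSet_cube a l
  have hfin := hσ.weightMeasure_cube_ne_top a l
  set f : (Fin n → ℝ) → ℝ := (cube a l).indicator fun _ => 1
  have hσf : (fun x => σ x * f x) = (cube a l).indicator σ := by
    ext x
    by_cases h : x ∈ cube a l <;> simp [f, h]
  have h := hC f (memLp_indicator_const _ hm _ (Or.inr hfin))
  rw [hσf, eLpNorm_indicator_const hm (by simpa using hp0) (by simp),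
    ENNReal.toReal_ofReal hp0.le, enorm_one, one_mul, one_div, ENNReal.rpow_inv_le_iff hp0,
    ENNReal.mul_rpow_of_nonneg _ _ hp0.le, ENNReal.rpow_inv_rpow hp0.ne'] at h
  rw [one_div, ENNReal.rpow_inv_le_iff hp0, ← weightMeasure_cube]
  exact ENNReal.div_le_of_le_mul ((setLIntegral_le_lintegral _ _).trans h)

/-- The strong-type estimate for a dyadic maximal function. -/
theorem lintegral_dyadic_le (hσ : IsWeight σ) (hn : 1 ≤ n) {p : ℝ} (hp : 1 < p)
    (μ : Measure ((Fin n → ℝ) × ℝ≥0)) (α : Fin n → Bool) {f : (Fin n → ℝ) → ℝ}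
    (hf : AEMeasurable f (weightMeasure σ)) :
    ∫⁻ z, ⨆ q : ℤ × (Fin n → ℤ), (dyadicBox α q).indicator (fun _ =>
        ((∫⁻ y in dyadicCube α q, ‖σ y * f y‖ₑ) / volume (dyadicCube α q)) ^ p) z ∂μ ≤
      ENNReal.ofReal (2 ^ p * p / (p - 1)) *
        (testingConstant p μ σ ^ p * ∫⁻ x, ‖f x‖ₑ ^ p ∂weightMeasure σ) := by
  have hp0 : 0 < p := by linarith
  have h2 : ∀ k : ℤ, (0 : ℝ) < 2 ^ k := fun k => by positivity
  have hm : ∀ q, MeasurableSet (dyadicCube α q) := fun q => measurableSet_cube _ _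
  have hfin : ∀ q, weightMeasure σ (dyadicCube α q) ≠ ∞ := fun q =>
    hσ.weightMeasure_cube_ne_top _ _
  have : SFinite (weightMeasure σ) := by unfold weightMeasure; infer_instance
  set F := fun x => ‖hf.mk f x‖ₑ
  have hF : Measurable F := hf.measurable_mk.enorm
  have hfF : (fun x => ‖f x‖ₑ) =ᵐ[weightMeasure σ] F := by
    filter_upwards [hf.ae_eq_mk] with x hx
    rw [hx]
  have havg : ∀ q, (∫⁻ y in dyadicCube α q, ‖σ y * f y‖ₑ) / volume (dyadicCube α q) =
      weightMeasure σ (dyadicCube α q) / volume (dyadicCube α q) *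
        ((∫⁻ x in dyadicCube α q, F x ∂weightMeasure σ) / weightMeasure σ (dyadicCube α q)) := by
    intro q
    rw [hσ.setLIntegral_enorm_mul hf (hm q), lintegral_congr_ae (ae_restrict_of_ae hfF)]
    by_cases h0 : weightMeasure σ (dyadicCube α q) = 0
    · simp [Measure.restrict_eq_zero.2 h0]
    · rw [← ENNReal.mul_div_right_comm, ENNReal.mul_div_cancel h0 (hfin q)]
  simp_rw [havg]
  have hpow : ∫⁻ x, ‖f x‖ₑ ^ p ∂weightMeasure σ = ∫⁻ x, F x ^ p ∂weightMeasure σ :=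
    lintegral_congr_ae (hfF.fun_comp (· ^ p))
  rw [hpow]
  -- Applied with `s q = σ(Q)/|Q|`.
  refine lintegral_iSup_average_rpow_le hm hfin (dyadicCube_nested α)
    (fun q => measurableSet_carlesonBox _ _)
    (fun q r h => carlesonBox_subset hn (h2 _).le h) hp
    (M := fun r z => carlesonMaximal ((dyadicCube α r).indicator σ) z ^ p)
    (fun q r hqr z hz => ?_) (fun r => hσ.lintegral_carlesonBox_le hp μ _ (h2 _)) hF
  refine ENNReal.rpow_le_rpow (le_trans ?_ (le_carlesonMaximal (h2 _) hz)) hp0.le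
  rw [dyadicCube, weightMeasure_cube]
  gcongr ?_ / _
  refine setLIntegral_mono' (hm q) fun x hx => ?_
  rw [indicator_of_mem (hqr hx)]
  exact Real.ofReal_le_enorm _

theorem strongTypeNorm_le (hσ : IsWeight σ) (hn : 1 ≤ n) {p : ℝ} (hp : 1 < p)
    (μ : Measure ((Fin n → ℝ) × ℝ≥0)) :
    strongTypeNorm p μ σ ≤ 6 ^ n *
      (Fintype.card (Fin n → Bool) * ENNReal.ofReal (2 ^ p * p / (p - 1))) ^ (1 / p) *
        testingConstant p μ σ := by
  have hp0 : 0 < p := by linarith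
  refine sInf_le fun f hf => ?_
  have hfm : AEMeasurable f (weightMeasure σ) := hf.1.aemeasurable
  set u : (Fin n → Bool) → ((Fin n → ℝ) × ℝ≥0) → ℝ≥0∞ := fun α z =>
    ⨆ q : ℤ × (Fin n → ℤ), (dyadicBox α q).indicator (fun _ =>
      ((∫⁻ y in dyadicCube α q, ‖σ y * f y‖ₑ) / volume (dyadicCube α q)) ^ p) z
  have hu : ∀ α, Measurable (u α) := fun α =>
    Measurable.iSup fun q => measurable_const.indicator (measurableSet_carlesonBox _ _)
  -- The supremum over the `2^n` grids is replaced by a sum, a measurable majorant, at the cost of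
  -- the cardinality factor.
  have hpt : ∀ z, carlesonMaximal (fun x => σ x * f x) z ^ p ≤ (6 ^ n) ^ p * ∑ α, u α z := by
    intro z
    refine (ENNReal.rpow_le_rpow (carlesonMaximal_le_dyadic _ z) hp0.le).trans ?_
    rw [ENNReal.mul_rpow_of_nonneg _ _ hp0.le]
    gcongr
    rw [← ENNReal.le_rpow_inv_iff hp0]
    refine iSup₂_le fun α q => ?_
    rw [ENNReal.le_rpow_inv_iff hp0]
    refine le_trans ?_ (Finset.single_le_sum (f := fun α => u α z) (fun _ _ => zero_le)
      (Finset.mem_univ α))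
    refine le_iSup_of_le q ?_
    by_cases hz : z ∈ dyadicBox α q <;> simp [hz, hp0]
  have hint : ∫⁻ z, carlesonMaximal (fun x => σ x * f x) z ^ p ∂μ ≤
      (6 ^ n) ^ p * (Fintype.card (Fin n → Bool) * (ENNReal.ofReal (2 ^ p * p / (p - 1)) *
        (testingConstant p μ σ ^ p * ∫⁻ x, ‖f x‖ₑ ^ p ∂weightMeasure σ))) := by
    refine (lintegral_mono hpt).trans ?_
    rw [lintegral_const_mul _ (Finset.measurable_sum _ fun α _ => hu α),
      lintegral_finsetSum _ fun α _ => hu α]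
    gcongr
    refine (Finset.sum_le_card_nsmul _ _ _ fun α _ =>
      hσ.lintegral_dyadic_le hn hp μ α hfm).trans_eq ?_
    rw [nsmul_eq_mul, Finset.card_univ]
  rw [eLpNorm_eq_lintegral_rpow_enorm_toReal (by simpa using hp0) (by simp),
    ENNReal.toReal_ofReal hp0.le]
  refine (ENNReal.rpow_le_rpow hint (by positivity)).trans_eq ?_
  have hi : 0 ≤ 1 / p := by positivity
  simp only [ENNReal.mul_rpow_of_nonneg _ _ hi]
  rw [one_div, ENNReal.rpow_rpow_inv hp0.ne', ENNReal.rpow_rpow_inv hp0.ne']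
  ring

end IsWeight

end Cubes

theorem theorem2p2 (n : ℕ) (hn : 1 ≤ n) (p : ℝ) (hp : 1 < p) :
    ∃ C : ℝ≥0, 0 < C ∧
      ∀ (μ : Measure ((Fin n → ℝ) × ℝ≥0)) (σ : (Fin n → ℝ) → ℝ), IsWeight σ →
        testingConstant p μ σ ≤ (C : ℝ≥0∞) * strongTypeNorm p μ σ ∧
        strongTypeNorm p μ σ ≤ (C : ℝ≥0∞) * testingConstant p μ σ := by
  have hp0 : 0 < p := by linarith
  set K : ℝ≥0∞ := 6 ^ n *
    (Fintype.card (Fin n → Bool) * ENNReal.ofReal (2 ^ p * p / (p - 1))) ^ (1 / p)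
  have hK : K ≠ ∞ := ENNReal.mul_ne_top (by simp)
    (ENNReal.rpow_ne_top_of_nonneg (by positivity) (ENNReal.mul_ne_top (by simp) (by simp)))
  refine ⟨1 + K.toNNReal, by positivity, fun μ σ hσ => ?_⟩
  rw [ENNReal.coe_add, ENNReal.coe_toNNReal hK, ENNReal.coe_one]
  refine ⟨(hσ.testingConstant_le hp μ).trans ?_, (hσ.strongTypeNorm_le hn hp μ).trans ?_⟩
  · rw [add_mul, one_mul]
    exact le_self_add
  · rw [add_mul]
    exact le_add_self
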